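/- Let $n\ge 2$ be an integer and let $D_n=\{1,\mu,\dots,\mu^{n-1},\tau,\mu\tau,\dots,\mu^{n-1}\tau\}$ be the dihedral group of order $2n$, with $\mu^n=\tau^2=1$ and $\tau\mu=\mu^{-1}\tau$. A projective unitary representation of $D_n$ of dimension $n$ is a map $\pi:D_n\to U(n)$ such that for all $g,g'\in D_n$ the matrix $\pi(gg')$ equals $\pi(g)\pi(g')$ up to a unimodular scalar; it is equivalent to a homomorphism $\rho:D_n\to U(n)$ if there is $Q\in U(n)$ such that for every $g\in D_n$ the matrix $Q\pi(g)Q^*$ equals $\rho(g)$ up to a unimodular scalar. A dihedral configuration in $\mathbb{C}^n$ is the family of $2n$ vectors $D_nv=(\pi(g)v)_{g\in D_n}$, where $\pi$ is a projective unitary representation of $D_n$ of dimension $n$ and $v\in\mathbb{C}^n$ is a unit vector. It is called strict if $\pi$ is equivalent to a homomorphism $D_n\to U(n)$, and regular if $\pi(1)v,\pi(\mu)v,\dots,\pi(\mu^{n-1})v$ is a basis of $\mathbb{C}^n$. It is a dihedral $\mathrm{ETF}(2n,n)$ if it is an equiangular tight frame: there is $A>0$ with $\sum_{g\in D_n}|\langle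 x,\pi(g)v\rangle|^2=A\|x\|^2$ for all $x\in\mathbb{C}^n$, and $|\langle \pi(g)v,\pi(h)v\rangle|$ takes the same value for all $g\ne h$ in $D_n$. Then: (a) If $n$ is odd, there is no regular dihedral $\mathrm{ETF}(2n,n)$. (b) There is no strict regular dihedral $\mathrm{ETF}(2n,n)$. -/

import Mathlib

/-- Projective equality of complex matrices: `a` is a unimodular multiple of `b`. -/
def ProjEq {n : ℕ} (a b : Matrix (Fin n) (Fin n) ℂ) : Prop :=
  ∃ α : ℂ, ‖α‖ = 1 ∧ a = α • b

/-- A projective unitary representation of `G` of dimension `n`: a map `π : G → U(n)` with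
`π (g g')` projectively equal to `π g π g'`. Strict representations are the homomorphisms
`G →* U(n)`. -/
structure ProjUnitaryRep (G : Type*) [Group G] (n : ℕ) where
  toFun : G → Matrix.unitaryGroup (Fin n) ℂ
  map_mul_projEq : ∀ g g' : G,
    ProjEq (toFun (g * g') : Matrix (Fin n) (Fin n) ℂ)
      ((toFun g : Matrix (Fin n) (Fin n) ℂ) * (toFun g' : Matrix (Fin n) (Fin n) ℂ))

namespace ProjUnitaryRep

variable {G : Type*} [Group G] {n : ℕ}

/-- A strict representation, seen as a projective one. -/
def ofStrict (ρ : G →* Matrix.unitaryGroup (Fin n) ℂ) : ProjUnitaryRep G n where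
  toFun := ρ
  map_mul_projEq g g' := ⟨1, by simp, by simp⟩

/-- Equivalence of projective unitary representations: there is a unitary `Q` with
`Q π(g) Q*` projectively equal to `π'(g)` for every `g`. -/
def Equivalent (π π' : ProjUnitaryRep G n) : Prop :=
  ∃ Q : Matrix.unitaryGroup (Fin n) ℂ, ∀ g : G,
    ProjEq ((Q * π.toFun g * star Q : Matrix.unitaryGroup (Fin n) ℂ) : Matrix (Fin n) (Fin n) ℂ)
      (π'.toFun g : Matrix (Fin n) (Fin n) ℂ)

/-- The vector `π(g) v`. -/
noncomputable def act (π : ProjUnitaryRep G n) (g : G) (v : EuclideanSpace ℂ (Fin n)) :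
    EuclideanSpace ℂ (Fin n) :=
  WithLp.toLp 2 (Matrix.mulVec (π.toFun g : Matrix (Fin n) (Fin n) ℂ) (WithLp.ofLp v))

end ProjUnitaryRep

/-- An `N`-point configuration of unit vectors in `ℂⁿ` is a tight frame: for some `A > 0`,
`∑ⱼ |⟨x, φⱼ⟩|² = A ‖x‖²` for all `x`. -/
def IsTightFrame {N n : ℕ} (Φ : Fin N → EuclideanSpace ℂ (Fin n)) : Prop :=
  ∃ A : ℝ, 0 < A ∧ ∀ x : EuclideanSpace ℂ (Fin n),
    ∑ j, ‖inner ℂ x (Φ j)‖ ^ 2 = A * ‖x‖ ^ 2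

/-- `Φ` is an `ETF(N, n)`: unit vectors forming a tight frame, with `|⟨φᵢ, φⱼ⟩|` constant over
all `i ≠ j`. -/
def IsETF {N n : ℕ} (Φ : Fin N → EuclideanSpace ℂ (Fin n)) : Prop :=
  (∀ j, ‖Φ j‖ = 1) ∧ IsTightFrame Φ ∧
    ∃ c : ℝ, ∀ i j : Fin N, i ≠ j → ‖inner ℂ (Φ i) (Φ j)‖ = c

/-- The data of a dihedral configuration `Dₙ v` in `ℂⁿ`: a projective unitary representation of the
dihedral group of order `2n` of dimension `n`, and a unit fiducial vector. -/
structure DihedralConfig (n : ℕ) where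
  rep : ProjUnitaryRep (DihedralGroup n) n
  fiducial : EuclideanSpace ℂ (Fin n)
  norm_fiducial : ‖fiducial‖ = 1

namespace DihedralConfig

variable {n : ℕ}

/-- The generator `μ` of the rotations. -/
def mu (n : ℕ) : DihedralGroup n := DihedralGroup.r 1

/-- The reflection `τ`. -/
def tau (n : ℕ) : DihedralGroup n := DihedralGroup.sr 0

/-- The `2n` vectors of `Dₙ v`, in the order `1, μ, …, μⁿ⁻¹, τ, μτ, …, μⁿ⁻¹τ` of `Dₙ`. -/
noncomputable def vectors (D : DihedralConfig n) (k : Fin (2 * n)) : EuclideanSpace ℂ (Fin n) :=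
  D.rep.act (mu n ^ (k.val % n) * tau n ^ (k.val / n)) D.fiducial

/-- `Dₙ v` is strict if its representation is equivalent to a strict one. -/
def IsStrict (D : DihedralConfig n) : Prop :=
  ∃ ρ : DihedralGroup n →* Matrix.unitaryGroup (Fin n) ℂ,
    D.rep.Equivalent (ProjUnitaryRep.ofStrict ρ)

/-- `Dₙ v` is regular if `v, μ v, …, μⁿ⁻¹ v` is a basis of `ℂⁿ`. -/
def IsRegular (D : DihedralConfig n) : Prop :=
  LinearIndependent ℂ (fun i : Fin n => D.rep.act (mu n ^ i.val) D.fiducial) ∧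
    Submodule.span ℂ (Set.range fun i : Fin n => D.rep.act (mu n ^ i.val) D.fiducial) = ⊤

end DihedralConfig

/-!
The theorem is reduced to an honest unitary representation `ρ` of the dihedral group. In the strict
case this is the hypothesis (`ProjUnitaryRep.exists_projEq_of_equivalent`); for odd `n` every
projective representation can be rescaled to a homomorphism, since the obstruction is an `n`-th root
of unity modulo squares (`exists_dihedral_lift_of_odd`).

Put `a j = ⟨v, ρ (r j) v⟩` and `b j = ⟨v, ρ (sr j) v⟩`, where `r j` are the rotations and `sr j` the
reflections, `j ∈ ℤ/n`. The frame operator of the orbit of `v` is a scalar `A`, and it is the sum of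
the frame operators of the two half orbits. The first commutes with the rotations, hence, `v` being
cyclic, equals `∑ j, conj (a j) ρ (r j)`; the second is its conjugate by a reflection, that is
`∑ j, a j ρ (r j)`. Since the rotated vectors are linearly independent, `A = 2` and `a j` is purely
imaginary for `j ≠ 0` (`conj_inner_rotation_add`). The numbers `b j` are real because reflections
are involutions. With the common modulus `c`, which is nonzero, `a j = i c s j` for `j ≠ 0` and
`b j = c e j` with signs `s j` and `e j`.

The coefficient of the frame operator between `v` and `ρ (r d) v`, `d ≠ 0`, is
`∑ j, a j a (d - j) + ∑ j, b j b (j + d) = 2 a d`, that is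
`∑ j ∉ {0, d}, s j s (d - j) = ∑ j, e j e (j + d)`. The product of the terms is `1` on either side,
so modulo `4` either side equals its number of terms, which is `n - 2` on the left and `n` on the
right: a contradiction (`sum_sign_convolution_ne`).
-/

/-! ### Sums of signs modulo four -/

/-- For signs `x` and `y`, `(x - 1) * (y - 1)` is divisible by `4`, so `x + y ≡ x * y + 1`. Hence
the sum of a family of signs is determined modulo `4` by its length and its product. -/
theorem Finset.sum_sign_modEq_four {ι : Type*} (s : Finset ι) (f : ι → ℤ)
    (hf : ∀ i ∈ s, f i = 1 ∨ f i = -1) :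
    (∏ i ∈ s, f i = 1 ∨ ∏ i ∈ s, f i = -1) ∧
      ∑ i ∈ s, f i ≡ ∏ i ∈ s, f i + s.card - 1 [ZMOD 4] := by
  classical
  induction s using Finset.induction_on with
  | empty => simp
  | insert a s ha ih =>
    obtain ⟨hP, hS⟩ := ih fun i hi => hf i (Finset.mem_insert_of_mem hi)
    rw [Finset.prod_insert ha, Finset.sum_insert ha, Finset.card_insert_of_notMem ha]
    push_cast
    unfold Int.ModEq at *
    rcases hf a (Finset.mem_insert_self a s) with h | h <;> rcases hP with hP | hP <;>
      rw [hP] at hS ⊢ <;> rw [h] <;> refine ⟨by norm_num, ?_⟩ <;> omega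

/-- The parity obstruction. In both sums the product of all the terms is `1`, because each sign
occurs twice; the left sum has `n - 2` terms and the right one `n`, so they differ by `2` modulo `4`.
The value `s 0` plays no role. -/
theorem sum_sign_convolution_ne {n : ℕ} [NeZero n] (s e : ZMod n → ℤ)
    (hs : ∀ j, j ≠ 0 → s j = 1 ∨ s j = -1) (he : ∀ j, e j = 1 ∨ e j = -1)
    {d : ZMod n} (hd : d ≠ 0) :
    ∑ j ∈ Finset.univ \ {0, d}, s j * s (d - j) ≠ ∑ j, e j * e (j + d) := by
  intro h
  have mul_sign : ∀ x y : ℤ, (x = 1 ∨ x = -1) → (y = 1 ∨ y = -1) → (x * y = 1 ∨ x * y = -1) := by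
    rintro x y (rfl | rfl) (rfl | rfl) <;> norm_num
  have sq_sign : ∀ x : ℤ, (x = 1 ∨ x = -1) → x * x = 1 := by
    rintro x (rfl | rfl) <;> norm_num
  set t : Finset (ZMod n) := Finset.univ \ {0, d} with ht
  have mem_t : ∀ j, j ∈ t ↔ j ≠ 0 ∧ j ≠ d := by intro j; simp [ht]
  have h1 := Finset.sum_sign_modEq_four t (fun j => s j * s (d - j)) fun j hj =>
    mul_sign _ _ (hs _ ((mem_t j).1 hj).1) (hs _ (sub_ne_zero.2 ((mem_t j).1 hj).2.symm))
  have h2 := Finset.sum_sign_modEq_four Finset.univ (fun j => e j * e (j + d)) fun j _ =>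
    mul_sign _ _ (he _) (he _)
  have hP2 : ∏ j, e j * e (j + d) = 1 := by
    have : ∏ j, e (j + d) = ∏ j, e j := Fintype.prod_equiv (Equiv.addRight d) _ _ fun _ => rfl
    rw [Finset.prod_mul_distrib, this, ← Finset.prod_mul_distrib]
    exact Finset.prod_eq_one fun j _ => sq_sign _ (he j)
  have hP1 : ∏ j ∈ t, s j * s (d - j) = 1 := by
    have : ∏ j ∈ t, s (d - j) = ∏ j ∈ t, s j := by
      refine Finset.prod_nbij' (fun j => d - j) (fun j => d - j) ?_ ?_ ?_ ?_ ?_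
      · intro j hj
        rw [mem_t] at hj ⊢
        exact ⟨sub_ne_zero.2 hj.2.symm, fun h => hj.1 (by simpa using h)⟩
      · intro j hj
        rw [mem_t] at hj ⊢
        exact ⟨sub_ne_zero.2 hj.2.symm, fun h => hj.1 (by simpa using h)⟩
      all_goals simp
    rw [Finset.prod_mul_distrib, this, ← Finset.prod_mul_distrib]
    exact Finset.prod_eq_one fun j hj => sq_sign _ (hs j ((mem_t j).1 hj).1)
  have hcard : t.card + 2 = n := by
    have h3 := Finset.card_sdiff_add_card_eq_card (Finset.subset_univ ({0, d} : Finset (ZMod n)))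
    rwa [Finset.card_pair hd.symm, Finset.card_univ, ZMod.card] at h3
  have h1 := h1.2
  have h2 := h2.2
  rw [hP1, h] at h1
  rw [hP2, Finset.card_univ, ZMod.card] at h2
  have := h1.symm.trans h2
  unfold Int.ModEq at this
  omega

/-! ### Frame operators -/

section InnerProductSpace
variable {E : Type*} [NormedAddCommGroup E] [InnerProductSpace ℂ E]

/-- Polarization of the tight frame identity: the frame operator is the scalar `A`. -/
theorem sum_inner_smul_eq_of_tight {ι : Type*} [Fintype ι] (Φ : ι → E) (A : ℝ)
    (h : ∀ x : E, ∑ i, ‖inner ℂ x (Φ i)‖ ^ 2 = A * ‖x‖ ^ 2) (x : E) :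
    ∑ i, inner ℂ (Φ i) x • Φ i = (A : ℂ) • x := by
  let S : E →ₗ[ℂ] E := ∑ i, (innerₛₗ ℂ (Φ i)).smulRight (Φ i)
  have hS : ∀ x, S x = ∑ i, inner ℂ (Φ i) x • Φ i := fun x => by simp [S, LinearMap.sum_apply]
  have : S = (A : ℂ) • LinearMap.id := by
    rw [← ext_inner_map]
    intro x
    have h := congrArg (fun t : ℝ => (t : ℂ)) (h x)
    simp only [Complex.ofReal_sum, Complex.ofReal_mul, Complex.ofReal_pow] at h
    rw [hS, sum_inner, LinearMap.smul_apply, LinearMap.id_apply, inner_smul_left,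
      Complex.conj_ofReal, inner_self_eq_norm_sq_to_K]
    refine Eq.trans (Finset.sum_congr rfl fun i _ => ?_) h
    rw [inner_smul_left, inner_conj_symm]
    rw [← inner_conj_symm (Φ i) x, Complex.mul_conj, Complex.normSq_eq_norm_sq]
    push_cast; rfl
  rw [← hS, this]; rfl

/-! ### Equiangular tight orbits of the dihedral group -/

open DihedralGroup

theorem sum_dihedralGroup {n : ℕ} [NeZero n] {M : Type*} [AddCommMonoid M]
    (f : DihedralGroup n → M) : ∑ g, f g = ∑ j, f (r j) + ∑ j, f (sr j) := by
  rw [← DihedralGroup.equivSum.symm.sum_comp, Fintype.sum_sum_type]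
  rfl

theorem inner_rep_rep {G : Type*} [Group G] (σ : Representation ℂ G E)
    (hσ : ∀ g x y, inner ℂ (σ g x) (σ g y) = inner ℂ x y) (g h : G) (x y : E) :
    inner ℂ (σ g x) (σ h y) = inner ℂ x (σ (g⁻¹ * h) y) := by
  rw [← hσ g⁻¹, ← Module.End.mul_apply, ← Module.End.mul_apply, ← map_mul, ← map_mul]
  simp

/-- The frame operator of the orbit of `v` under the rotations commutes with the rotations. As `v`
is a cyclic vector for them, it is a combination of rotations, whose coefficients are read off from
its value at `v`. -/
theorem sum_rotation_smul_eq {n : ℕ} [NeZero n] (σ : Representation ℂ (DihedralGroup n) E)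
    (hσ : ∀ g x y, inner ℂ (σ g x) (σ g y) = inner ℂ x y) (v : E)
    (hspan : Submodule.span ℂ (Set.range fun j : ZMod n => σ (r j) v) = ⊤) (x : E) :
    ∑ j, inner ℂ (σ (r j) v) x • σ (r j) v = ∑ j, inner ℂ (σ (r j) v) v • σ (r j) x := by
  let S : E →ₗ[ℂ] E := ∑ j, (innerₛₗ ℂ (σ (r j) v)).smulRight (σ (r j) v)
  let P : E →ₗ[ℂ] E := ∑ j, (inner ℂ (σ (r j) v) v : ℂ) • σ (r j)
  have hS : ∀ x, S x = ∑ j, inner ℂ (σ (r j) v) x • σ (r j) v := fun x => by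
    simp [S, LinearMap.sum_apply]
  have hP : ∀ x, P x = ∑ j, inner ℂ (σ (r j) v) v • σ (r j) x := fun x => by
    simp [P, LinearMap.sum_apply]
  rw [← hS, ← hP]
  refine congrArg (fun f : E →ₗ[ℂ] E => f x) (LinearMap.ext_on hspan ?_)
  rintro _ ⟨k, rfl⟩
  change S (σ (r k) v) = P (σ (r k) v)
  rw [hS, hP, ← Equiv.sum_comp (Equiv.addRight k)]
  refine Finset.sum_congr rfl fun j _ => ?_
  have h1 : inner ℂ (σ (r j) v) v = inner ℂ v (σ (r (-j)) v) := by
    simpa [inv_r] using inner_rep_rep σ hσ (r j) 1 v v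
  rw [← Module.End.mul_apply, ← map_mul, r_mul_r, inner_rep_rep σ hσ, h1, inv_r, r_mul_r]
  simp

/-- Conjugation by a reflection inverts the rotations, so it turns the rotation part
`∑ j, ⟨r j v, v⟩ • σ (r j)` of the frame operator into the reflection part
`∑ j, ⟨r (-j) v, v⟩ • σ (r j)`. Their sum is the scalar `A`; comparing the coefficients of the
basis vectors `σ (r j) v` gives the claim. -/
theorem conj_inner_rotation_add {n : ℕ} [NeZero n] (σ : Representation ℂ (DihedralGroup n) E)
    (hσ : ∀ g x y, inner ℂ (σ g x) (σ g y) = inner ℂ x y) (v : E)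
    (hli : LinearIndependent ℂ fun j : ZMod n => σ (r j) v)
    (hspan : Submodule.span ℂ (Set.range fun j : ZMod n => σ (r j) v) = ⊤) {A : ℂ}
    (hA : ∑ g, inner ℂ (σ g v) v • σ g v = A • v) (j : ZMod n) :
    starRingEnd ℂ (inner ℂ v (σ (r j) v)) + inner ℂ v (σ (r j) v) = if j = 0 then A else 0 := by
  have hrefl : ∑ j, inner ℂ (σ (sr j) v) v • σ (sr j) v =
      ∑ j, inner ℂ v (σ (r j) v) • σ (r j) v := by
    have h1 : ∀ j : ZMod n, inner ℂ (σ (sr j) v) v • σ (sr j) v =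
        σ (sr 0) (inner ℂ (σ (r j) v) (σ (sr 0) v) • σ (r j) v) := fun j => by
      have h2 : inner ℂ (σ (sr j) v) v = inner ℂ (σ (r j) v) (σ (sr 0) v) := by
        simpa [inv_r, inner_rep_rep σ hσ, r_mul_sr] using inner_rep_rep σ hσ (sr j) 1 v v
      rw [h2, map_smul, ← Module.End.mul_apply, ← map_mul, sr_mul_r, zero_add]
    rw [Finset.sum_congr rfl fun j _ => h1 j, ← map_sum, sum_rotation_smul_eq σ hσ v hspan,
      map_sum, ← Equiv.sum_comp (Equiv.neg _)]
    refine Finset.sum_congr rfl fun j _ => ?_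
    have h3 : inner ℂ (σ (r (-j)) v) v = inner ℂ v (σ (r j) v) := by
      simpa [inv_r] using inner_rep_rep σ hσ (r (-j)) 1 v v
    rw [Equiv.neg_apply, h3, map_smul, ← Module.End.mul_apply, ← Module.End.mul_apply, ← map_mul,
      ← map_mul, sr_mul_r, sr_mul_sr]
    simp
  rw [sum_dihedralGroup, hrefl, ← Finset.sum_add_distrib] at hA
  have h0 : A • v = ∑ j : ZMod n, (if j = 0 then A else 0) • σ (r j) v := by
    simp [ite_smul]
  rw [h0, ← sub_eq_zero, ← Finset.sum_sub_distrib] at hA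
  have := Fintype.linearIndependent_iff.1 hli
    (fun j => inner ℂ (σ (r j) v) v + inner ℂ v (σ (r j) v) - if j = 0 then A else 0)
    (by rw [← hA]; exact Finset.sum_congr rfl fun j _ => by rw [sub_smul, add_smul]) j
  rw [inner_conj_symm]
  exact sub_eq_zero.1 this

/-- The orbit of `v` under a unitary representation of the dihedral group is not an equiangular
tight frame if the rotations carry `v` to a basis. Write `a j = ⟨v, r j v⟩` and `b j = ⟨v, sr j v⟩`. Here
`a j = ± i c` for `j ≠ 0` by `conj_inner_rotation_add`, and `b j = ± c` because reflections are
self-adjoint; the frame identity then contradicts `sum_sign_convolution_ne`. -/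
theorem not_equiangular_of_tight_of_basis {n : ℕ} (hn : 1 < n) [NeZero n]
    (σ : Representation ℂ (DihedralGroup n) E)
    (hσ : ∀ g x y, inner ℂ (σ g x) (σ g y) = inner ℂ x y) (v : E) (hv : ‖v‖ = 1)
    (hli : LinearIndependent ℂ fun j : ZMod n => σ (r j) v)
    (hspan : Submodule.span ℂ (Set.range fun j : ZMod n => σ (r j) v) = ⊤) (A : ℝ)
    (hA : ∀ x, ∑ g, ‖inner ℂ x (σ g v)‖ ^ 2 = A * ‖x‖ ^ 2) (c : ℝ)
    (hc : ∀ g, g ≠ 1 → ‖inner ℂ v (σ g v)‖ = c) : False := by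
  have hframe := sum_inner_smul_eq_of_tight (fun g => σ g v) A hA
  set a : ZMod n → ℂ := fun j => inner ℂ v (σ (r j) v) with ha
  set b : ZMod n → ℂ := fun j => inner ℂ v (σ (sr j) v) with hb
  have ha0 : a 0 = 1 := by simp [ha, hv, inner_self_eq_norm_sq_to_K]
  have hskew := conj_inner_rotation_add σ hσ v hli hspan (hframe v)
  have hA2 : A = 2 := by
    have := hskew 0
    change starRingEnd ℂ (a 0) + a 0 = _ at this
    rw [ha0, if_pos rfl, map_one] at this
    exact_mod_cast (show (A : ℂ) = 2 by rw [← this]; norm_num)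
  have hac : ∀ j, j ≠ 0 → ‖a j‖ = c := fun j hj => hc _ fun h => hj (by
    rw [one_def] at h; exact r.inj h)
  have hbc : ∀ j, ‖b j‖ = c := fun j => hc _ fun h => by rw [one_def] at h; cases h
  -- With `c = 0` the frame identity at `v` would read `1 = A = 2`.
  have hc0 : c ≠ 0 := by
    rintro rfl
    have := hA v
    rw [Finset.sum_eq_single 1 (fun g _ hg => by rw [hc g hg]; norm_num) (by simp)] at this
    norm_num [hv, hA2, inner_self_eq_norm_sq_to_K] at this
  have hare : ∀ j, j ≠ 0 → ∃ s : ℤ, (s = 1 ∨ s = -1) ∧ a j = s * (Complex.I * c) := by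
    intro j hj
    have h := hskew j
    change starRingEnd ℂ (a j) + a j = _ at h
    rw [if_neg hj, add_comm, Complex.add_conj] at h
    have hre : (a j).re = 0 := by exact_mod_cast (by simpa using h : ((a j).re : ℂ) = 0)
    have h2 : (a j).im ^ 2 = c ^ 2 := by
      rw [← hac j hj, Complex.sq_norm, Complex.normSq_apply, hre]; ring
    rcases sq_eq_sq_iff_eq_or_eq_neg.1 h2 with h2 | h2
    · exact ⟨1, Or.inl rfl, by apply Complex.ext <;> simp [hre, h2]⟩
    · exact ⟨-1, Or.inr rfl, by apply Complex.ext <;> simp [hre, h2]⟩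
  have hbre : ∀ j, ∃ s : ℤ, (s = 1 ∨ s = -1) ∧ b j = s * c := by
    intro j
    have h : starRingEnd ℂ (b j) = b j := by
      rw [hb]
      simpa using inner_rep_rep σ hσ (sr j) 1 v v
    have him : (b j).im = 0 := Complex.conj_eq_iff_im.1 h
    have h2 : (b j).re ^ 2 = c ^ 2 := by
      rw [← hbc j, Complex.sq_norm, Complex.normSq_apply, him]; ring
    rcases sq_eq_sq_iff_eq_or_eq_neg.1 h2 with h2 | h2
    · exact ⟨1, Or.inl rfl, by apply Complex.ext <;> simp [him, h2]⟩
    · exact ⟨-1, Or.inr rfl, by apply Complex.ext <;> simp [him, h2]⟩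
  choose e he hbe using hbre
  have : ∃ s : ZMod n → ℤ, ∀ j, j ≠ 0 → (s j = 1 ∨ s j = -1) ∧ a j = s j * (Complex.I * c) := by
    choose! s hs using hare
    exact ⟨s, hs⟩
  obtain ⟨s, hs⟩ := this
  obtain ⟨d, hd⟩ : ∃ d : ZMod n, d ≠ 0 := by
    have : Fact (1 < n) := ⟨hn⟩
    exact exists_ne 0
  -- The matrix coefficient at `v`, `σ (r d) v` of the frame identity.
  have hconv : ∑ j, a j * a (d - j) + ∑ j, b j * b (j + d) = 2 * a d := by
    have h := congrArg (fun x => inner ℂ v x) (hframe (σ (r d) v))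
    simp only [inner_sum, inner_add_right, inner_smul_right, hA2, sum_dihedralGroup,
      inner_rep_rep σ hσ, inv_r, inv_sr, r_mul_r, sr_mul_r] at h
    refine Eq.trans (congrArg₂ _ (Finset.sum_congr rfl fun j _ => ?_)
      (Finset.sum_congr rfl fun j _ => mul_comm _ _)) (h.trans (by norm_num [ha]))
    rw [mul_comm, sub_eq_neg_add]
  refine sum_sign_convolution_ne s e (fun j hj => (hs j hj).1) he hd ?_
  -- The terms `j = 0` and `j = d` of the first sum are both `a d`, and cancel the right-hand side.
  rw [← Finset.sum_sdiff (Finset.subset_univ ({0, d} : Finset (ZMod n))), Finset.sum_pair hd.symm,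
    ha0, sub_zero, sub_self, ha0] at hconv
  have h1 : ∑ j ∈ Finset.univ \ {0, d}, a j * a (d - j) =
      ((∑ j ∈ Finset.univ \ {0, d}, s j * s (d - j) : ℤ) : ℂ) * -(c : ℂ) ^ 2 := by
    rw [Int.cast_sum, Finset.sum_mul]
    refine Finset.sum_congr rfl fun j hj => ?_
    simp only [Finset.mem_sdiff, Finset.mem_insert, Finset.mem_singleton, not_or] at hj
    rw [(hs j hj.2.1).2, (hs (d - j) (sub_ne_zero.2 (Ne.symm hj.2.2))).2]
    push_cast
    linear_combination (s j * s (d - j) * (c : ℂ) ^ 2) * Complex.I_sq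
  have h2 : ∑ j, b j * b (j + d) = ((∑ j, e j * e (j + d) : ℤ) : ℂ) * (c : ℂ) ^ 2 := by
    rw [Int.cast_sum, Finset.sum_mul]
    refine Finset.sum_congr rfl fun j _ => ?_
    rw [hbe, hbe]
    push_cast
    ring
  rw [h1, h2] at hconv
  have hc2 : (c : ℂ) ^ 2 ≠ 0 := pow_ne_zero _ (by exact_mod_cast hc0)
  have := mul_right_cancel₀ hc2 (show ((∑ j ∈ Finset.univ \ {0, d}, s j * s (d - j) : ℤ) : ℂ) *
    (c : ℂ) ^ 2 = ((∑ j, e j * e (j + d) : ℤ) : ℂ) * (c : ℂ) ^ 2 by linear_combination -hconv)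
  exact_mod_cast this

end InnerProductSpace

/-! ### Homomorphisms out of the dihedral group -/

open DihedralGroup in
/-- Existence part of the universal property of the presentation `⟨u, t | u ^ n = t ^ 2 = 1, t u t = u⁻¹⟩`. -/
theorem DihedralGroup.exists_hom {H : Type*} [Group H] {n : ℕ} (u t : H) (hu : u ^ n = 1)
    (ht : t * t = 1) (htu : t * u * t = u⁻¹) :
    ∃ ρ : DihedralGroup n →* H, ρ (r 1) = u ∧ ρ (sr 0) = t := by
  let f : ZMod n →+ Additive H := ZMod.lift n ⟨zmultiplesHom (Additive H) (Additive.ofMul u), by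
    simp [← ofMul_pow, hu]⟩
  have hfz : ∀ k : ℤ, (f (k : ZMod n)).toMul = u ^ k := fun k => by
    simp [f, ZMod.lift_coe]
  have hf0 : (f 0).toMul = 1 := by rw [map_zero]; rfl
  have hf : ∀ i j, (f (i + j)).toMul = (f i).toMul * (f j).toMul := fun i j => by
    rw [map_add]; rfl
  have hc : ∀ i, t * (f i).toMul = (f (-i)).toMul * t := fun i => by
    obtain ⟨k, rfl⟩ := ZMod.intCast_surjective i
    have h2 : t⁻¹ = t := inv_eq_of_mul_eq_one_left ht
    have h3 : MulAut.conj t u = u⁻¹ := by rw [MulAut.conj_apply, h2, htu]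
    have h4 : MulAut.conj t (u ^ k) = u ^ (-k) := by rw [map_zpow, h3, inv_zpow']
    rw [← Int.cast_neg, hfz, hfz, ← h4, MulAut.conj_apply, h2, mul_assoc, ht, mul_one]
  refine ⟨MonoidHom.mk' (fun g => match g with
      | r i => (f i).toMul
      | sr i => t * (f i).toMul) ?_, ?_, ?_⟩
  · rintro (i | i) (j | j)
    · simp only [r_mul_r, hf]
    · simp only [r_mul_sr]
      rw [← mul_assoc, ← neg_neg i, ← hc, mul_assoc, ← hf, neg_neg, sub_eq_neg_add]
    · simp only [sr_mul_r, hf, mul_assoc]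
    · simp only [sr_mul_sr]
      rw [hc, mul_assoc, ← mul_assoc t, ht, one_mul, ← hf, sub_eq_neg_add]
  · change (f 1).toMul = u
    rw [← Int.cast_one, hfz, zpow_one]
  · change t * (f 0).toMul = t
    rw [hf0, mul_one]

open DihedralGroup in
theorem DihedralGroup.hom_ext {M : Type*} [Group M] {n : ℕ} {f g : DihedralGroup n →* M}
    (hr : f (r 1) = g (r 1)) (hs : f (sr 0) = g (sr 0)) : f = g := by
  have h : ∀ i : ZMod n, f (r i) = g (r i) := fun i => by
    obtain ⟨k, rfl⟩ := ZMod.intCast_surjective i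
    rw [← r_one_zpow, map_zpow, map_zpow, hr]
  ext (i | i)
  · exact h i
  · rw [← zero_add i, ← sr_mul_r, map_mul, map_mul, hs, h]

/-! ### Lifting projective representations of odd dihedral groups -/

theorem Circle.exists_pow_eq (z : Circle) {k : ℕ} (hk : k ≠ 0) : ∃ w : Circle, w ^ k = z := by
  refine ⟨Circle.exp (Complex.arg z / k), ?_⟩
  rw [← Circle.exp_natCast_mul, mul_div_cancel₀ _ (Nat.cast_ne_zero.2 hk), Circle.exp_arg]

open DihedralGroup in
/-- For odd `n`, homomorphisms from the dihedral group lift along a central extension by a quotient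
of the circle. Lifts `u`, `t` of the generators can be rescaled so that `u ^ n = t ^ 2 = 1`; then
`t u t = z u⁻¹` with a central `z` such that `z ^ n = 1`, and the defect `z` is removed by
multiplying `u` by a square root of `z⁻¹` among the powers of `z`, which exists as `n` is odd. -/
theorem exists_dihedral_lift_of_odd {H : Type*} [Group H] {n : ℕ} (hn : Odd n)
    (Z : Circle →* H) (hZ : ∀ z h, Commute (Z z) h) [Z.range.Normal]
    (f : DihedralGroup n →* H ⧸ Z.range) :
    ∃ ρ : DihedralGroup n →* H, (QuotientGroup.mk' Z.range).comp ρ = f := by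
  have hmk : ∀ z h, QuotientGroup.mk' Z.range (Z z * h) = QuotientGroup.mk' Z.range h :=
    fun z h => by
      have h1 : QuotientGroup.mk' Z.range (Z z) = 1 := (QuotientGroup.eq_one_iff _).2 ⟨z, rfl⟩
      rw [map_mul, h1, one_mul]
  have key : ∀ x : H ⧸ Z.range, ∀ k : ℕ, k ≠ 0 → x ^ k = 1 →
      ∃ h : H, h ^ k = 1 ∧ QuotientGroup.mk' Z.range h = x := by
    intro x k hk hx
    obtain ⟨h, rfl⟩ := QuotientGroup.mk'_surjective Z.range x
    rw [← map_pow] at hx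
    obtain ⟨z, hz⟩ := (QuotientGroup.eq_one_iff _).1 hx
    obtain ⟨w, hw⟩ := Circle.exists_pow_eq z⁻¹ hk
    refine ⟨Z w * h, ?_, hmk w h⟩
    rw [(hZ w h).mul_pow, ← map_pow, hw, ← hz, ← map_mul, inv_mul_cancel, map_one]
  obtain ⟨u, hu, hfu⟩ := key (f (r 1)) n hn.pos.ne' (by rw [← map_pow, r_one_pow_n, map_one])
  obtain ⟨t, ht, hft⟩ := key (f (sr 0)) 2 two_ne_zero (by
    rw [← map_pow, sq, sr_mul_self, map_one])
  rw [sq] at ht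
  obtain ⟨α, hα⟩ : t * u * t * u ∈ Z.range := by
    rw [← QuotientGroup.eq_one_iff]
    change QuotientGroup.mk' Z.range _ = 1
    rw [map_mul, map_mul, map_mul, hfu, hft, ← map_mul, ← map_mul, ← map_mul, sr_mul_r, sr_mul_sr,
      r_mul_r, ← map_one f, one_def]
    simp
  have htut : t * u * t = Z α * u⁻¹ := by rw [hα, mul_inv_cancel_right]
  have hαn : Z α ^ n = 1 := by
    have h1 : (t * u * t) ^ n = 1 := by
      have h2 := conj_pow (i := n) (a := t) (b := u)
      rw [inv_eq_of_mul_eq_one_left ht, hu] at h2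
      rw [h2, mul_one, ht]
    rwa [htut, (hZ _ _).mul_pow, inv_pow, hu, inv_one, mul_one] at h1
  -- With `n = 2 * m + 1`, the square of `Z α ^ m` is `(Z α)⁻¹`, as `Z α ^ n = 1`.
  obtain ⟨m, hm⟩ := hn
  have hcomm : ∀ h, Commute (Z α ^ m) h := fun h => (hZ α h).pow_left m
  have hpow : (Z α ^ m * u) ^ n = 1 := by
    rw [(hcomm u).mul_pow, hu, mul_one, ← pow_mul, mul_comm, pow_mul, hαn, one_pow]
  have hconj : t * (Z α ^ m * u) * t = (Z α ^ m * u)⁻¹ := by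
    rw [← mul_assoc t, ← (hcomm t).eq, mul_assoc (Z α ^ m), mul_assoc (Z α ^ m), htut,
      eq_inv_iff_mul_eq_one, (hcomm u).eq]
    calc Z α ^ m * (Z α * u⁻¹) * (u * Z α ^ m) = Z α ^ n := by rw [hm]; group
      _ = 1 := hαn
  obtain ⟨ρ, hρu, hρt⟩ := DihedralGroup.exists_hom (Z α ^ m * u) t hpow ht hconj
  refine ⟨ρ, DihedralGroup.hom_ext ?_ ?_⟩
  · rw [MonoidHom.comp_apply, hρu, ← map_pow, hmk, hfu]
  · rw [MonoidHom.comp_apply, hρt, hft]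

/-! ### From dihedral configurations to unitary representations -/

/-- The unimodular scalars inside the unitary group. -/
noncomputable def unitaryScalar (n : ℕ) : Circle →* Matrix.unitaryGroup (Fin n) ℂ where
  toFun z := ⟨(z : ℂ) • 1, by
    rw [Matrix.mem_unitaryGroup_iff, star_smul, star_one, smul_mul_smul_comm, mul_one,
      ← starRingEnd_apply, Complex.mul_conj, Circle.normSq_coe]
    simp⟩
  map_one' := by ext; simp
  map_mul' z w := by ext; simp [mul_assoc, mul_left_comm]

theorem coe_unitaryScalar_mul {n : ℕ} (z : Circle) (u : Matrix.unitaryGroup (Fin n) ℂ) :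
    ((unitaryScalar n z * u : Matrix.unitaryGroup (Fin n) ℂ) : Matrix (Fin n) (Fin n) ℂ) =
      (z : ℂ) • (u : Matrix (Fin n) (Fin n) ℂ) := by
  change ((z : ℂ) • (1 : Matrix (Fin n) (Fin n) ℂ)) * (u : Matrix (Fin n) (Fin n) ℂ) = _
  rw [smul_mul_assoc, one_mul]

theorem commute_unitaryScalar {n : ℕ} (z : Circle) (u : Matrix.unitaryGroup (Fin n) ℂ) :
    Commute (unitaryScalar n z) u := by
  refine Subtype.ext ?_
  rw [coe_unitaryScalar_mul]
  change _ = (u : Matrix (Fin n) (Fin n) ℂ) * ((z : ℂ) • 1)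
  rw [mul_smul_comm, mul_one]

instance normal_range_unitaryScalar (n : ℕ) : (unitaryScalar n).range.Normal where
  conj_mem := by
    rintro _ ⟨z, rfl⟩ g
    exact ⟨z, by rw [← (commute_unitaryScalar z g).eq, mul_inv_cancel_right]⟩

/-- Projective equality of unitary matrices is equality in the projective unitary group. -/
theorem projEq_iff_mk_eq {n : ℕ} (u w : Matrix.unitaryGroup (Fin n) ℂ) :
    ProjEq (u : Matrix (Fin n) (Fin n) ℂ) (w : Matrix (Fin n) (Fin n) ℂ) ↔
      QuotientGroup.mk' (unitaryScalar n).range u = QuotientGroup.mk' (unitaryScalar n).range w := by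
  rw [eq_comm, QuotientGroup.mk'_apply, QuotientGroup.mk'_apply, QuotientGroup.eq]
  constructor
  · rintro ⟨α, hα, h⟩
    obtain ⟨z, rfl⟩ : ∃ z : Circle, (z : ℂ) = α := ⟨⟨α, mem_sphere_zero_iff_norm.2 hα⟩, rfl⟩
    refine ⟨z, ?_⟩
    rw [eq_inv_mul_iff_mul_eq, ← (commute_unitaryScalar _ w).eq]
    exact Subtype.ext ((coe_unitaryScalar_mul _ _).trans h.symm)
  · rintro ⟨z, hz⟩
    rw [eq_inv_mul_iff_mul_eq, ← (commute_unitaryScalar _ w).eq] at hz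
    exact ⟨z, z.norm_coe, by rw [← hz, coe_unitaryScalar_mul]⟩

namespace ProjUnitaryRep

variable {G : Type*} [Group G] {n : ℕ}

/-- A projective unitary representation, seen as a homomorphism to the projective unitary group
`U(n) / U(1)`. -/
noncomputable def toQuotient (π : ProjUnitaryRep G n) :
    G →* Matrix.unitaryGroup (Fin n) ℂ ⧸ (unitaryScalar n).range :=
  MonoidHom.mk' (fun g => QuotientGroup.mk' (unitaryScalar n).range (π.toFun g)) fun g h => by
    rw [← map_mul]
    exact (projEq_iff_mk_eq _ _).1 (π.map_mul_projEq g h)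

theorem exists_projEq_of_odd (hn : Odd n) (π : ProjUnitaryRep (DihedralGroup n) n) :
    ∃ ρ : DihedralGroup n →* Matrix.unitaryGroup (Fin n) ℂ, ∀ g,
      ProjEq (π.toFun g : Matrix (Fin n) (Fin n) ℂ) (ρ g : Matrix (Fin n) (Fin n) ℂ) := by
  obtain ⟨ρ, hρ⟩ := exists_dihedral_lift_of_odd hn (unitaryScalar n) commute_unitaryScalar
    π.toQuotient
  exact ⟨ρ, fun g => (projEq_iff_mk_eq _ _).2 (DFunLike.congr_fun hρ g).symm⟩

/-- The intertwining unitary can be absorbed into the homomorphism by conjugating it. -/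
theorem exists_projEq_of_equivalent (π : ProjUnitaryRep G n)
    (ρ : G →* Matrix.unitaryGroup (Fin n) ℂ) (h : π.Equivalent (ofStrict ρ)) :
    ∃ ρ' : G →* Matrix.unitaryGroup (Fin n) ℂ, ∀ g,
      ProjEq (π.toFun g : Matrix (Fin n) (Fin n) ℂ) (ρ' g : Matrix (Fin n) (Fin n) ℂ) := by
  obtain ⟨Q, hQ⟩ := h
  refine ⟨(MulAut.conj Q⁻¹).toMonoidHom.comp ρ, fun g => ?_⟩
  have h1 := (projEq_iff_mk_eq _ _).1 (hQ g)
  refine (projEq_iff_mk_eq _ _).2 ?_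
  change QuotientGroup.mk' _ (Q * π.toFun g * Q⁻¹) = QuotientGroup.mk' _ (ρ g) at h1
  change _ = QuotientGroup.mk' _ (Q⁻¹ * ρ g * Q⁻¹⁻¹)
  rw [map_mul, map_mul, ← h1]
  simp only [map_mul, map_inv]
  group

end ProjUnitaryRep

/-- The linear representation on `ℂⁿ` given by a homomorphism to the unitary group. -/
noncomputable def unitaryRepresentation {G : Type*} [Group G] {n : ℕ}
    (ρ : G →* Matrix.unitaryGroup (Fin n) ℂ) : Representation ℂ G (EuclideanSpace ℂ (Fin n)) where
  toFun g := Matrix.toEuclideanLin (ρ g : Matrix (Fin n) (Fin n) ℂ)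
  map_one' := by ext; simp
  map_mul' g h := by
    ext x i
    simp [Matrix.toEuclideanLin, Matrix.toLpLin_apply, Matrix.mulVec_mulVec]

theorem inner_unitaryRepresentation {G : Type*} [Group G] {n : ℕ}
    (ρ : G →* Matrix.unitaryGroup (Fin n) ℂ) (g : G) (x y : EuclideanSpace ℂ (Fin n)) :
    inner ℂ (unitaryRepresentation ρ g x) (unitaryRepresentation ρ g y) = inner ℂ x y := by
  have hU : star (ρ g : Matrix (Fin n) (Fin n) ℂ) * ρ g = 1 :=
    Matrix.mem_unitaryGroup_iff'.1 (ρ g).2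
  rw [EuclideanSpace.inner_eq_star_dotProduct, EuclideanSpace.inner_eq_star_dotProduct,
    dotProduct_comm, dotProduct_comm (WithLp.ofLp y)]
  change star ((ρ g : Matrix (Fin n) (Fin n) ℂ).mulVec x.ofLp) ⬝ᵥ
    (ρ g : Matrix (Fin n) (Fin n) ℂ).mulVec y.ofLp = _
  rw [Matrix.star_mulVec, Matrix.dotProduct_mulVec, Matrix.vecMul_vecMul,
    ← Matrix.star_eq_conjTranspose, hU, Matrix.vecMul_one]

theorem act_eq_smul_of_projEq {G : Type*} [Group G] {n : ℕ} (π : ProjUnitaryRep G n)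
    (ρ : G →* Matrix.unitaryGroup (Fin n) ℂ)
    (h : ∀ g, ProjEq (π.toFun g : Matrix (Fin n) (Fin n) ℂ) (ρ g : Matrix (Fin n) (Fin n) ℂ)) :
    ∃ α : G → ℂ, (∀ g, ‖α g‖ = 1) ∧
      ∀ g v, π.act g v = α g • unitaryRepresentation ρ g v := by
  choose α hα h using h
  refine ⟨α, hα, fun g v => ?_⟩
  rw [ProjUnitaryRep.act, h, Matrix.smul_mulVec]
  rfl

namespace DihedralConfig

/-- The words `μ ^ i τ ^ s`, in the order used by `DihedralConfig.vectors`, list each element of the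
dihedral group exactly once. -/
theorem bijective_word {n : ℕ} [NeZero n] : Function.Bijective
    fun k : Fin (2 * n) => mu n ^ (k.val % n) * tau n ^ (k.val / n) := by
  rw [Fintype.bijective_iff_surjective_and_card]
  refine ⟨?_, by rw [Fintype.card_fin, DihedralGroup.card]⟩
  have hn := Nat.pos_of_neZero n
  rintro (j | j)
  · have hj := j.val_lt
    refine ⟨⟨j.val, by omega⟩, ?_⟩
    simp [mu, tau, Nat.mod_eq_of_lt hj, Nat.div_eq_of_lt hj]
  · have hj := (-j).val_lt
    refine ⟨⟨(-j).val + n, by omega⟩, ?_⟩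
    simp [mu, tau, Nat.mod_eq_of_lt hj, Nat.div_eq_of_lt hj,
      Nat.add_div_right _ hn, DihedralGroup.r_mul_sr]

/-- The phases relating `D.rep` to `ρ` affect neither the moduli of inner products nor the
regularity of the configuration, so `not_equiangular_of_tight_of_basis` applies to the orbit under `ρ`. -/
theorem not_isETF_of_projEq {n : ℕ} (hn : 1 < n) (D : DihedralConfig n)
    (ρ : DihedralGroup n →* Matrix.unitaryGroup (Fin n) ℂ)
    (hρ : ∀ g, ProjEq (D.rep.toFun g : Matrix (Fin n) (Fin n) ℂ)
      (ρ g : Matrix (Fin n) (Fin n) ℂ))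
    (hreg : D.IsRegular) : ¬ IsETF D.vectors := by
  rintro ⟨-, ⟨A, -, hA⟩, c, hc⟩
  have : NeZero n := ⟨by omega⟩
  obtain ⟨α, hα, hact⟩ := act_eq_smul_of_projEq D.rep ρ hρ
  set σ := unitaryRepresentation ρ with hσ
  set v := D.fiducial with hv
  have hα0 : ∀ g, α g ≠ 0 := fun g h => by simpa [h] using hα g
  let e := Equiv.ofBijective _ (bijective_word (n := n))
  have hvec : ∀ g, D.vectors (e.symm g) = α g • σ g v := fun g => by
    rw [← hact]
    exact congrArg (fun g => D.rep.act g v) (e.apply_symm_apply g)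
  have hrot : ∀ j : ZMod n, mu n ^ j.val = DihedralGroup.r j := fun j => by
    rw [mu, DihedralGroup.r_one_pow, ZMod.natCast_zmod_val]
  let φ : ZMod n → Fin n := fun j => ⟨j.val, j.val_lt⟩
  refine not_equiangular_of_tight_of_basis hn σ (inner_unitaryRepresentation ρ) v D.norm_fiducial
    ?_ ?_ A ?_ c ?_
  · have h1 := hreg.1.comp φ fun i j h => ZMod.val_injective n (Fin.mk.inj h)
    have h2 := h1.units_smul fun j => (Units.mk0 _ (hα0 (DihedralGroup.r j)))⁻¹
    have h3 : (fun j => σ (DihedralGroup.r j) v) =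
        (fun j => (Units.mk0 _ (hα0 (DihedralGroup.r j)))⁻¹) •
          ((fun i : Fin n => D.rep.act (mu n ^ i.val) D.fiducial) ∘ φ) := funext fun j => by
      change _ = (Units.mk0 _ (hα0 (DihedralGroup.r j)))⁻¹ • D.rep.act (mu n ^ j.val) v
      rw [hrot, hact, Units.smul_def, Units.val_inv_eq_inv_val, Units.val_mk0,
        inv_smul_smul₀ (hα0 _)]
    rw [h3]
    exact h2
  · rw [eq_top_iff, ← hreg.2, Submodule.span_le]
    rintro _ ⟨i, rfl⟩
    change D.rep.act (DihedralGroup.r 1 ^ i.val) v ∈ _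
    rw [hact, DihedralGroup.r_one_pow]
    exact Submodule.smul_mem _ _ (Submodule.subset_span ⟨_, rfl⟩)
  · intro x
    rw [← hA x, ← e.symm.sum_comp]
    refine Finset.sum_congr rfl fun g _ => ?_
    rw [hvec, inner_smul_right, norm_mul, hα, one_mul]
  · intro g hg
    have h := hc (e.symm 1) (e.symm g) fun h => hg (e.symm.injective h).symm
    rw [hvec, hvec, inner_smul_left, inner_smul_right, norm_mul, norm_mul, hα, RCLike.norm_conj,
      hα, one_mul, one_mul] at h
    simpa using h

end DihedralConfig

/-! ### Nonexistence of regular dihedral ETFs -/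

theorem mainTheorem3 (n : ℕ) (hn : 1 < n) :
    (Odd n → ¬ ∃ D : DihedralConfig n, D.IsRegular ∧ IsETF D.vectors) ∧
    (¬ ∃ D : DihedralConfig n, D.IsStrict ∧ D.IsRegular ∧ IsETF D.vectors) := by
  constructor
  · rintro hodd ⟨D, hreg, hetf⟩
    obtain ⟨ρ, hρ⟩ := D.rep.exists_projEq_of_odd hodd
    exact D.not_isETF_of_projEq hn ρ hρ hreg hetf
  · rintro ⟨D, ⟨ρ, hequiv⟩, hreg, hetf⟩
    obtain ⟨ρ', hρ'⟩ := D.rep.exists_projEq_of_equivalent ρ hequiv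
    exact D.not_isETF_of_projEq hn ρ' hρ' hreg hetf
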